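/- Let $k$ be an algebraically closed field of characteristic $0$, and let $A=\bigoplus_{\nu\ge 0}A_\nu$ be a positively graded normal affine domain over $k$ (so $k\subseteq A_0$, and $A_0\neq k$ is allowed) with saturation index $e(A)=\gcd\{\nu : A_\nu\neq 0\}=1$. Put $Y=\operatorname{Proj}A$ and identify the function field $k(Y)$ with the degree-zero part $(\operatorname{Frac}A)_0$. Let $H$ be an ample $\mathbb Q$-divisor on $Y$ (that is, $nH$ is an ample Cartier divisor for some integer $n>0$) and let $w\in(\operatorname{Frac}A)_1$ be a nonzero homogeneous rational function of degree $1$ such that $$A_\nu=H^0(Y,\mathcal O_Y(\lfloor \nu H\rfloor))\,w^\nu\qquad\text{for all }\nu\ge 0 .$$ Let $D$ be an effective $\mathbb Q$-divisor on $Y$ and let $p,q$ be coprime positive integers with $D\sim\frac pq H$, meaning that $D-\frac pq H=\operatorname{div}\varphi$ for a nonzero rational function $\varphi$ on $Y$. Suppose that $$Y\setminus\operatorname{supp}D\;\simeq\; Z\times\mathbb A^1$$ over $k$ for some variety $Z$. Let $V^{(p)}=\operatorname{Spec}A^{(p)}$, where $A^{(p)}=\bigoplus_{\nu\ge 0}A_{p\nu}$,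 be the $p$-th Veronese quasicone. For $h\in A^{(p)}$ write $\mathbb D(h)=V^{(p)}\setminus\{h=0\}$. Then $V^{(p)}$ is cylindrical, i.e. it contains a nonempty principal open subset isomorphic over $k$ to the product of a variety and $\mathbb A^1$. More precisely, $Z$ is affine, and there are a nonzero $h\in A_p$ and an affine variety $Z'$ with $$\mathbb D(h)\simeq Z'\times\mathbb A^1,\qquad Z'\simeq Z\times\mathbb A^1_*,\qquad \mathbb A^1_*=\mathbb A^1\setminus\{0\},$$ where the isomorphisms are over $k$. -/

import Mathlib

open AlgebraicGeometry CategoryTheory CategoryTheory.Limits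

universe u

noncomputable section

namespace Cylindrical

/-! ### Varieties and cylinders over a field -/

section Varieties

variable (k : Type u) [Field k]

/-- The category of schemes over the field `k`. -/
abbrev KScheme : Type (u + 1) := Over (Spec (CommRingCat.of k))

/-- The spectrum of a `k`-algebra, as a `k`-scheme. -/
def specOver (B : Type u) [CommRing B] [Algebra k B] : KScheme k :=
  Over.mk (Spec.map (CommRingCat.ofHom (algebraMap k B)))

/-- The affine line over `k`. -/
def affineLine : KScheme k := specOver k (Polynomial k)

/-- The punctured affine line over `k`, the spectrum of the ring of Laurent polynomials. -/
def puncturedLine : KScheme k := specOver k (LaurentPolynomial k)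

variable {k}

/-- A variety over `k`: an integral separated scheme of finite type over `k`. -/
structure IsVariety (Z : KScheme k) : Prop where
  integral : IsIntegral Z.left
  separated : IsSeparated Z.hom
  locallyOfFiniteType : LocallyOfFiniteType Z.hom
  quasiCompact : QuasiCompact Z.hom

/-- The principal open subset `D(h)` of `Spec B`, as a `k`-scheme. -/
def principalOpen (k : Type u) [Field k] {B : Type u} [CommRing B] [Algebra k B] (h : B) :
    KScheme k :=
  Over.mk (Scheme.Opens.ι (X := Spec (CommRingCat.of B)) (PrimeSpectrum.basicOpen h) ≫
    (specOver k B).hom)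

/-- The affine scheme `Spec B` over `k` is cylindrical: it contains a nonempty principal open subset
`D(h) ≅ Z × 𝔸¹` for some variety `Z`. (For a domain `B`, `D(h)` is nonempty, equivalently dense,
if and only if `h ≠ 0`.) -/
def IsCylindrical (k : Type u) [Field k] (B : Type u) [CommRing B] [Algebra k B] : Prop :=
  ∃ h : B, h ≠ 0 ∧ ∃ Z : KScheme k, IsVariety Z ∧
    Nonempty (principalOpen k h ≅ Z ⨯ affineLine k)

end Varieties

/-! ### Weil `ℚ`-divisors -/

section Divisors

/-- A Weil `ℚ`-divisor on a Noetherian integral scheme `X`: a finite formal combination of prime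
divisors with rational coefficients. A prime divisor is given by its generic point, a point of
codimension one. -/
abbrev QDivisor (X : Scheme.{u}) : Type u := {x : X // Order.coheight x = 1} →₀ ℚ

variable {X : Scheme.{u}}

/-- All coefficients of `D` are nonnegative. -/
def QDivisor.Effective (D : QDivisor X) : Prop := ∀ y, 0 ≤ D y

/-- The support of `D`: the union of the prime divisors that occur in `D`. -/
def QDivisor.supp (D : QDivisor X) : Set X :=
  ⋃ y ∈ D.support, closure {(y : X)}

/-- The open complement of the support of `D`. -/
def QDivisor.complement (D : QDivisor X) : X.Opens where
  carrier := (QDivisor.supp D)ᶜ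
  is_open' := by
    refine isOpen_compl_iff.mpr ?_
    unfold QDivisor.supp
    exact Set.Finite.isClosed_biUnion D.support.finite_toSet fun _ _ => isClosed_closure

variable [IsIntegral X] [IsLocallyNoetherian X]

/-- `D ∼ D'`: the difference `D - D'` is the divisor of a nonzero rational function. -/
def QDivisor.LinEquiv (D D' : QDivisor X) : Prop :=
  ∃ f : X.functionField, f ≠ 0 ∧ ∀ y, D y - D' y = (Scheme.ord f (y : X) : ℚ)

/-- `D` is an integral Cartier divisor: near every point it is the divisor of a rational function. -/
def QDivisor.IsCartier (D : QDivisor X) : Prop :=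
  ∀ x : X, ∃ U : X.Opens, x ∈ U ∧ ∃ f : X.functionField, f ≠ 0 ∧
    ∀ y : {y : X // Order.coheight y = 1}, (y : X) ∈ U → D y = (Scheme.ord f (y : X) : ℚ)

/-- `D` is ample (on a normal Noetherian scheme): some multiple `nD`, `n > 0`, is Cartier and the
invertible sheaf `𝒪(nD)` is ample, that is, `X` is covered by affine open subsets of the form
`{s ≠ 0}` with `s` a global section of some power `𝒪(nD)^m`, `m > 0`. The nonzero sections
`s` correspond to the effective divisors `E` linearly equivalent to `m(nD)`, and
`{s ≠ 0}` is the complement of the support of `E`. -/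
def QDivisor.IsAmple (D : QDivisor X) : Prop :=
  ∃ n : ℕ, 0 < n ∧ QDivisor.IsCartier ((n : ℚ) • D) ∧
    ∀ x : X, ∃ m : ℕ, 0 < m ∧ ∃ E : QDivisor X, QDivisor.Effective E ∧
      QDivisor.LinEquiv E ((m : ℚ) • ((n : ℚ) • D)) ∧
      x ∈ QDivisor.complement E ∧ IsAffineOpen (QDivisor.complement E)

/-- The set of global sections of the sheaf `𝒪(⌊D⌋)`: the rational functions `f` with `f = 0` or
`div f + ⌊D⌋ ≥ 0`. -/
def QDivisor.sections (D : QDivisor X) : Set X.functionField :=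
  {f | f = 0 ∨ ∀ y : {y : X // Order.coheight y = 1}, 0 ≤ Scheme.ord f (y : X) + ⌊D y⌋}

end Divisors

/-! ### Positively graded affine domains and their `Proj` -/

section Graded

variable {k : Type u} [Field k] {A : Type u} [CommRing A] [Algebra k A]

/-- The saturation index `e(A) = gcd {ν | A_ν ≠ 0}` is equal to one. -/
class SaturationIndexOne (𝒜 : ℕ → Submodule k A) : Prop where
  eq_one_of_dvd : ∀ d : ℕ, (∀ ν, 𝒜 ν ≠ ⊥ → d ∣ ν) → d = 1

variable (𝒜 : ℕ → Submodule k A) [GradedAlgebra 𝒜]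

/-- The `d`-th Veronese subring `A^(d) = ⨁ A_{dν}`. -/
def veronese (d : ℕ) : Subalgebra k A :=
  (⨆ ν : ℕ, 𝒜 (d * ν)).toSubalgebra
    (Submodule.mem_iSup_of_mem 0 (by simpa using SetLike.one_mem_graded 𝒜))
    (by
      intro x y hx hy
      induction hx using Submodule.iSup_induction' with
      | zero => simp
      | add a b _ _ ha hb => rw [add_mul]; exact add_mem ha hb
      | mem i a ha =>
        induction hy using Submodule.iSup_induction' with
        | zero => simp
        | add c d _ _ hc hd => rw [mul_add]; exact add_mem hc hd
        | mem j b hb =>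
          refine Submodule.mem_iSup_of_mem (i + j) ?_
          rw [mul_add]
          exact SetLike.mul_mem_graded ha hb)

/-- `Proj A` as a scheme over `k`: the structure morphism is `Proj A ⟶ Spec A₀ ⟶ Spec k`. -/
def projHom : Proj 𝒜 ⟶ Spec (CommRingCat.of k) :=
  Proj.toSpecZero 𝒜 ≫ Spec.map (CommRingCat.ofHom (algebraMap k (𝒜 0)))

/-- An open subset of `Proj A`, as a `k`-scheme. -/
def openOver (U : (Proj 𝒜).Opens) : KScheme k := Over.mk (U.ι ≫ projHom 𝒜)

instance isLocallyNoetherian_proj [Algebra.FiniteType k A] : IsLocallyNoetherian (Proj 𝒜) := by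
  have : IsNoetherianRing A := Algebra.FiniteType.isNoetherianRing k A
  have h0 : IsNoetherianRing (𝒜 0) := by
    refine isNoetherianRing_of_surjective A (𝒜 0)
      (GradedRing.projZeroRingHom' 𝒜) (GradedRing.projZeroRingHom'_surjective 𝒜)
  have := IsScalarTower.of_algebraMap_eq (R := k) (S := 𝒜 0) (A := A) fun _ => rfl
  have : Algebra.FiniteType (𝒜 0) A := Algebra.FiniteType.of_restrictScalars_finiteType k (𝒜 0) A
  exact LocallyOfFiniteType.isLocallyNoetherian (Proj.toSpecZero 𝒜)

variable [IsDomain A]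

/-- The local ring `A_(P)` of `Proj A` at a prime `P`, embedded into the fraction field of `A`. -/
def atPrimeToFrac (P : Ideal A) [P.IsPrime] :
    HomogeneousLocalization.AtPrime 𝒜 P →+* FractionRing A :=
  (IsLocalization.map (M := P.primeCompl) (T := nonZeroDivisors A) (S := Localization.AtPrime P)
    (FractionRing A) (RingHom.id A) P.primeCompl_le_nonZeroDivisors).comp
    (algebraMap (HomogeneousLocalization.AtPrime 𝒜 P) (Localization.AtPrime P))

instance isIntegral_proj [SaturationIndexOne 𝒜] : IsIntegral (Proj 𝒜) := by
  have hex : ∃ ν, 0 < ν ∧ 𝒜 ν ≠ ⊥ := by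
    by_contra! hcon
    have := SaturationIndexOne.eq_one_of_dvd (𝒜 := 𝒜) 0 (fun ν hν => by
      rcases Nat.eq_zero_or_pos ν with rfl | h
      · exact dvd_rfl
      · exact absurd (hcon ν h) hν)
    omega
  let η : Proj 𝒜 := (⟨⊥, by
      rw [HomogeneousIdeal.toIdeal_bot]
      exact Ideal.isPrime_bot, by
      obtain ⟨ν, hν, hne⟩ := hex
      obtain ⟨a, ha, ha0⟩ := (Submodule.ne_bot_iff _).mp hne
      intro hle
      refine ha0 ?_
      have hmem : a ∈ HomogeneousIdeal.irrelevant 𝒜 := by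
        rw [HomogeneousIdeal.mem_irrelevant_iff, GradedRing.proj_apply,
          DirectSum.decompose_of_mem_ne 𝒜 ha hν.ne']
      have hb := hle hmem
      change a ∈ (⊥ : HomogeneousIdeal 𝒜).toIdeal at hb
      rwa [HomogeneousIdeal.toIdeal_bot, Ideal.mem_bot] at hb⟩ : ProjectiveSpectrum 𝒜)
  have hη : ∀ x : Proj 𝒜, x ∈ closure {η} := fun x =>
    (ProjectiveSpectrum.le_iff_mem_closure (𝒜 := 𝒜) η x).mp (show (⊥ : HomogeneousIdeal 𝒜) ≤ _ from bot_le)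
  have : IrreducibleSpace (Proj 𝒜) := by
    have huniv : closure {η} = (Set.univ : Set (Proj 𝒜)) := Set.eq_univ_of_forall hη
    have : PreirreducibleSpace (Proj 𝒜) :=
      ⟨huniv ▸ (isIrreducible_singleton (x := η)).closure.isPreirreducible⟩
    exact { toNonempty := ⟨η⟩ }
  have hred : ∀ x : Proj 𝒜, _root_.IsReduced ((Proj 𝒜).presheaf.stalk x) := by
    intro x
    have hx : x.asHomogeneousIdeal.toIdeal.IsPrime := x.isPrime
    have h1 : _root_.IsReduced
        (HomogeneousLocalization.AtPrime 𝒜 x.asHomogeneousIdeal.toIdeal) :=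
      isReduced_of_injective
        (algebraMap _ (Localization.AtPrime x.asHomogeneousIdeal.toIdeal))
        (HomogeneousLocalization.val_injective _)
    exact isReduced_of_injective (Proj.stalkIso 𝒜 x).hom.hom
      (Proj.stalkIso 𝒜 x).commRingCatIsoToRingEquiv.injective
  have : IsReduced (Proj 𝒜) := isReduced_of_isReduced_stalk _
  exact isIntegral_of_irreducibleSpace_of_isReduced _

variable [SaturationIndexOne 𝒜]

/-- The canonical identification of the function field of `Proj A` with the subfield `(Frac A)₀` of
the fraction field of `A`. It is induced by the isomorphism of the stalk of `Proj A` at its generic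
point `P` with `A_(P)`. -/
def functionFieldToFrac : (Proj 𝒜).functionField →+* FractionRing A :=
  have : (genericPoint (Proj 𝒜)).asHomogeneousIdeal.toIdeal.IsPrime := (genericPoint (Proj 𝒜)).isPrime
  (atPrimeToFrac 𝒜 (genericPoint (Proj 𝒜)).asHomogeneousIdeal.toIdeal).comp
    (Proj.stalkIso 𝒜 (genericPoint (Proj 𝒜))).hom.hom

variable [Algebra.FiniteType k A]

/-- The pair `(Y, H)`, with `Y = Proj A`, and the nonzero homogeneous rational function
`w ∈ (Frac A)₁` present the graded domain `A` as `A(Y, H)`: the `ℚ`-divisor `H` is ample and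
`A_ν = H⁰(Y, 𝒪(⌊νH⌋)) w^ν` for all `ν ≥ 0`. -/
structure IsPresentation (w : FractionRing A) (H : QDivisor (Proj 𝒜)) : Prop where
  ample : QDivisor.IsAmple H
  homogeneous : ∃ (ν : ℕ) (a b : A), a ∈ 𝒜 (ν + 1) ∧ b ∈ 𝒜 ν ∧ a ≠ 0 ∧ b ≠ 0 ∧
    w = algebraMap A (FractionRing A) a / algebraMap A (FractionRing A) b
  image_eq : ∀ ν : ℕ, (algebraMap A (FractionRing A)) '' (𝒜 ν : Set A) =
    {x | ∃ f ∈ QDivisor.sections ((ν : ℚ) • H), x = functionFieldToFrac 𝒜 f * w ^ ν}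

end Graded

end Cylindrical

end

/-! Write `D - (p/q)H = div φ`. Then `qD = div(φ^q) + pH`, and since `D` is effective, `φ^q` is a
section of `𝒪(⌊pH⌋)`. Hence `h = φ^q w^p` is a nonzero element of `A_p` whose zero divisor, as a
section of `pH`, is `qD`.

The crux is that `Y \ supp D` equals `D₊(h)` (`IsPresentation.complement_eq_basicOpen`). Off `supp
D` the divisor of `h` vanishes, so by the Hartogs property of the normal scheme `Y` suitable
fractions with a power of `h` as denominator are regular, which keeps `h` from vanishing there.
Conversely, at the generic point of a component of `D`, ampleness supplies a section with zero
coefficient along that component. If `h` did not vanish there, a quotient of powers of this section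
and `h` would be regular of negative order.

Thus `Spec A_(h) ≃ Z × 𝔸¹`. As `h` has degree exactly `p`, every homogeneous element of `A^(p)` is a
power of `h` times an element of `A_(h)`, so `A^(p)[1/h] = A_(h)[h, h⁻¹]` (`veroneseAwayEquiv`).
Therefore `𝔻(h) ≃ (Z × 𝔸¹) × 𝔸¹_*`, and exchanging the last two factors gives the claim. Finally `Z`
is affine because the zero section embeds it as a closed subscheme of the affine scheme `Z × 𝔸¹`. -/

noncomputable section

namespace Cylindrical

/-! ### Hartogs' property on normal Noetherian schemes -/

section Hartogs

/-- In an integrally closed Noetherian domain, an element of the fraction field which is not in the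
ring already fails to lie in the localization at some prime of height one. -/
theorem exists_height_one_of_notMem_range {R K : Type*} [CommRing R] [IsDomain R]
    [IsNoetherianRing R] [IsIntegrallyClosed R] [Field K] [Algebra R K] [IsFractionRing R K]
    (g : K) (hg : g ∉ (algebraMap R K).range) :
    ∃ P : Ideal R, P.IsPrime ∧ P.height = 1 ∧
      ∀ s : R, algebraMap R K s * g ∈ (algebraMap R K).range → s ∈ P := by
  -- The annihilator of the class of `g` in `K/R` is the ideal of denominators of `g`. It lies in an
  -- associated prime `P`, the annihilator of the class of some `t`, and `P` turns out to have
  -- height one.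
  let M := K ⧸ (1 : Submodule R K)
  have hmem : ∀ z : K, (Submodule.Quotient.mk z : M) = 0 ↔ z ∈ (algebraMap R K).range := by
    intro z
    rw [Submodule.Quotient.mk_eq_zero, Submodule.mem_one]
    rfl
  obtain ⟨P, hP, hle⟩ := exists_le_isAssociatedPrime_of_isNoetherianRing R
    (Submodule.Quotient.mk g : M) (fun h => hg ((hmem g).mp h))
  have hprime := hP.isPrime
  rw [IsAssociatedPrime.eq_1] at hP
  obtain ⟨_, t', ht'⟩ := isAssociatedPrime_iff.mp ⟨hprime, hP.2⟩
  obtain ⟨t, rfl⟩ := Submodule.Quotient.mk_surjective _ t'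
  have hPt : ∀ r : R, r ∈ P ↔ algebraMap R K r * t ∈ (algebraMap R K).range := by
    intro r
    rw [ht', Submodule.mem_colon_singleton, ← Submodule.Quotient.mk_smul, Submodule.mem_bot, hmem,
      Algebra.smul_def]
  have hPne : P ≠ ⊥ := by
    obtain ⟨a, b, hb, rfl⟩ := IsFractionRing.div_surjective (A := R) t
    have hb0 : algebraMap R K b ≠ 0 := by simpa using nonZeroDivisors.ne_zero hb
    refine (Submodule.ne_bot_iff _).mpr ⟨b, (hPt b).mpr ⟨a, ?_⟩, nonZeroDivisors.ne_zero hb⟩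
    field_simp
  refine ⟨P, hprime, le_antisymm ?_ ?_, fun s hs => hle ?_⟩
  -- If `tP ⊆ P`, then `t` is integral over `R` by the determinant trick, hence lies in `R`, which
  -- is absurd. Otherwise `ty = s ∉ P` for some `y ∈ P`; then `sP ⊆ (y)`, so `P` is minimal over
  -- `(y)` and Krull's principal ideal theorem applies.
  · by_cases hstab : ∀ y ∈ Submodule.map (Algebra.linearMap R K) P, t * y ∈ Submodule.map (Algebra.linearMap R K) P
    · exfalso
      have hint : IsIntegral R t := by
        refine isIntegral_of_smul_mem_submodule (Submodule.map (Algebra.linearMap R K) P) ?_ ?_ t hstab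
        · obtain ⟨a, ha, ha0⟩ := (Submodule.ne_bot_iff _).mp hPne
          refine (Submodule.ne_bot_iff _).mpr ⟨algebraMap R K a, ⟨a, ha, rfl⟩, by simpa using ha0⟩
        · exact Submodule.FG.map _ (IsNoetherian.noetherian _)
      obtain ⟨y, hy⟩ := IsIntegrallyClosed.algebraMap_eq_of_integral hint
      exact hprime.ne_top ((Ideal.eq_top_iff_one _).mpr ((hPt 1).mpr ⟨y, by simp [hy]⟩))
    · push Not at hstab
      obtain ⟨_, ⟨y, hy, rfl⟩, hty⟩ := hstab
      obtain ⟨s, hs⟩ := (hPt y).mp hy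
      have hsP : s ∉ P := fun h => hty ⟨s, h, by
        simpa [mul_comm] using hs⟩
      have key : ∀ m ∈ P, ∃ c, s * m = y * c := by
        intro m hm
        obtain ⟨c, hc⟩ := (hPt m).mp hm
        refine ⟨c, IsFractionRing.injective R K ?_⟩
        rw [map_mul, map_mul, hs, hc]
        ring
      refine Ideal.height_le_one_of_isPrincipal_of_mem_minimalPrimes (Ideal.span {y}) P ?_
      refine ⟨⟨hprime, by simpa [Ideal.span_le] using hy⟩, fun Q hQ hQP m hm => ?_⟩
      obtain ⟨c, hc⟩ := key m hm
      have : s * m ∈ Q := hc ▸ Q.mul_mem_right c (hQ.2 (Ideal.mem_span_singleton_self y))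
      exact (hQ.1.mem_or_mem this).resolve_left fun h => hsP (hQP h)
  · rw [Order.one_le_iff_ne_zero, Ne, Ideal.height_eq_zero_iff,
      IsDomain.minimalPrimes_eq_singleton_bot]
    simpa using hPne
  · rw [Submodule.mem_colon_singleton, ← Submodule.Quotient.mk_smul, Submodule.mem_bot, hmem,
      Algebra.smul_def]
    exact hs

/-- A rational function of nonnegative order at a normal point of codimension one is regular
there. -/
theorem mem_range_stalk_of_ord_nonneg {X : Scheme.{u}} [IsIntegral X] [IsLocallyNoetherian X]
    {y : X} (hy : Order.coheight y = 1) [IsIntegrallyClosed (X.presheaf.stalk y)]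
    (f : X.functionField) (hf : 0 ≤ Scheme.ord f y) :
    f ∈ (algebraMap (X.presheaf.stalk y) X.functionField).range := by
  by_cases hf0 : f = 0
  · exact hf0 ▸ zero_mem _
  have hK : Ring.KrullDimLE 1 (X.presheaf.stalk y) := krullDimLE_of_coheight_le hy.le
  have hdim : ringKrullDim (X.presheaf.stalk y) = 1 := by
    rw [ringKrullDim_stalk_eq_coheight, hy]; rfl
  have hnf : ¬ IsField (X.presheaf.stalk y) := fun h => by
    rw [ringKrullDim_eq_zero_of_isField h] at hdim
    exact zero_ne_one hdim
  have hdvr : IsDiscreteValuationRing (X.presheaf.stalk y) := by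
    refine ((IsDiscreteValuationRing.TFAE _ hnf).out 0 2).mpr ?_
    exact { __ := (⟨fun hp0 hp => Ring.krullDimLE_one_iff_of_isPrime_bot.mp hK _ hp0 hp⟩ :
      Ring.DimensionLEOne (X.presheaf.stalk y)) }
  have h1 : 1 ≤ Ring.ordFrac (X.presheaf.stalk y) f := by
    have := (Scheme.le_ord_iff hy hf0 (n := 0)).mp hf
    simpa [Scheme.ordHom] using this
  -- The multiplicative valuation is the inverse of `ordFrac`, so nonnegative order means valuation
  -- at most one.
  rw [Ring.ordFrac_eq_valuation_inv] at h1
  exact IsDiscreteValuationRing.exists_lift_of_le_one ((one_le_inv₀ (by simpa [zero_lt_iff])).mp h1)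

/-- A regular function at a codimension one point has nonnegative order there. -/
theorem ord_nonneg_of_mem_range_stalk {X : Scheme.{u}} [IsIntegral X] [IsLocallyNoetherian X]
    (y : X) (f : X.functionField)
    (hf : f ∈ (algebraMap (X.presheaf.stalk y) X.functionField).range) :
    0 ≤ Scheme.ord f y := by
  -- Away from codimension one, `Scheme.ord` takes its default value `0`.
  by_cases hy : Order.coheight y = 1
  swap
  · simp [hy]
  by_cases hf0 : f = 0
  · simp [hf0]
  have hK : Ring.KrullDimLE 1 (X.presheaf.stalk y) := krullDimLE_of_coheight_le hy.le
  obtain ⟨s, rfl⟩ := hf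
  rw [Scheme.le_ord_iff hy hf0]
  have := Ring.ordFrac_ge_one_of_ne_zero (K := X.functionField) (x := s) (by rintro rfl; simp at hf0)
  simpa [Scheme.ordHom] using this

/-- On a normal integral scheme, a rational function of nonnegative order at all points of
codimension one specializing to `x` is regular at `x`. -/
theorem mem_range_stalk_of_forall_ord_nonneg {X : Scheme.{u}} [IsIntegral X]
    [IsLocallyNoetherian X] (hX : ∀ y : X, IsIntegrallyClosed (X.presheaf.stalk y)) (x : X)
    (f : X.functionField)
    (hf : ∀ y : X, Order.coheight y = 1 → y ⤳ x → 0 ≤ Scheme.ord f y) :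
    f ∈ (algebraMap (X.presheaf.stalk x) X.functionField).range := by
  by_contra hcon
  have := hX x
  obtain ⟨P, hP, hP1, hPf⟩ := exists_height_one_of_notMem_range f hcon
  obtain ⟨_, ⟨U, hU, rfl⟩, hxU, -⟩ :=
    X.isBasis_affineOpens.exists_subset_of_mem_open (Set.mem_univ x) isOpen_univ
  replace hU : IsAffineOpen U := hU
  have hne : Nonempty U := ⟨⟨x, hxU⟩⟩
  let _ := TopCat.Presheaf.algebra_section_stalk X.presheaf (⟨x, hxU⟩ : U)
  have hloc := hU.isLocalization_stalk ⟨x, hxU⟩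
  have htx : IsScalarTower Γ(X, U) (X.presheaf.stalk x) X.functionField :=
    functionField_isScalarTower X U ⟨x, hxU⟩
  -- Contracted to an affine neighbourhood of `x`, the height one prime `P` becomes a point `y` of
  -- codimension one that specializes to `x`.
  have hQ1 : (P.under Γ(X, U)).height = 1 := by
    rw [IsLocalization.height_under (hU.primeIdealOf ⟨x, hxU⟩).asIdeal.primeCompl]
    exact hP1
  let q : PrimeSpectrum Γ(X, U) := ⟨P.under Γ(X, U), inferInstance⟩
  let y : X := hU.fromSpec q
  have hyU : y ∈ U := by
    have : y ∈ Set.range hU.fromSpec := ⟨q, rfl⟩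
    rwa [hU.range_fromSpec] at this
  let _ := TopCat.Presheaf.algebra_section_stalk X.presheaf (⟨y, hyU⟩ : U)
  have hlocy : IsLocalization.AtPrime (X.presheaf.stalk y) q.asIdeal :=
    hU.isLocalization_stalk' q hyU
  have hty : IsScalarTower Γ(X, U) (X.presheaf.stalk y) X.functionField :=
    functionField_isScalarTower X U ⟨y, hyU⟩
  have hy1 : Order.coheight y = 1 := by
    have h := ringKrullDim_stalk_eq_coheight y
    rw [IsLocalization.AtPrime.ringKrullDim_eq_height q.asIdeal (X.presheaf.stalk y), hQ1] at h
    exact_mod_cast h.symm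
  have hle : q ≤ hU.primeIdealOf ⟨x, hxU⟩ := by
    intro b hb
    by_contra hbx
    exact hP.ne_top (Ideal.eq_top_of_isUnit_mem _ hb
      (IsLocalization.map_units (M := (hU.primeIdealOf ⟨x, hxU⟩).asIdeal.primeCompl)
        (X.presheaf.stalk x) ⟨b, hbx⟩))
  have hyx : y ⤳ x := by
    have h := ((PrimeSpectrum.le_iff_specializes _ _).mp hle).map hU.fromSpec.continuous
    rwa [hU.fromSpec_primeIdealOf] at h
  have := hX y
  obtain ⟨s, hs⟩ := mem_range_stalk_of_ord_nonneg hy1 f (hf y hy1 hyx)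
  -- Regularity at `y` gives `f = b/c` with `c` outside the prime of `y`; but `cf = b` makes `c` a
  -- denominator of `f`, which forces `c ∈ P`.
  obtain ⟨b, c, rfl⟩ := IsLocalization.exists_mk'_eq q.asIdeal.primeCompl s
  refine c.2 (hPf (algebraMap _ _ (c : Γ(X, U))) ⟨algebraMap _ _ b, ?_⟩)
  rw [← IsScalarTower.algebraMap_apply, ← IsScalarTower.algebraMap_apply, ← hs,
    IsScalarTower.algebraMap_apply Γ(X, U) (X.presheaf.stalk y) X.functionField c, ← map_mul,
    IsLocalization.mk'_spec', ← IsScalarTower.algebraMap_apply]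

end Hartogs

/-! ### Local rings of `Proj A` inside `Frac A` -/

section ProjStalks

variable {k : Type u} [Field k] {A : Type u} [CommRing A] [Algebra k A]
  (𝒜 : ℕ → Submodule k A) [GradedAlgebra 𝒜] [IsDomain A]

/-- The canonical map from the localization of a domain at a prime to its fraction field. -/
def localizationToFrac {A : Type*} [CommRing A] [IsDomain A] (P : Ideal A) [P.IsPrime] :
    Localization.AtPrime P →+* FractionRing A :=
  IsLocalization.map (M := P.primeCompl) (T := nonZeroDivisors A) (S := Localization.AtPrime P)
    (FractionRing A) (RingHom.id A) P.primeCompl_le_nonZeroDivisors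

theorem localizationToFrac_algebraMap {A : Type*} [CommRing A] [IsDomain A] (P : Ideal A)
    [P.IsPrime] (a : A) : localizationToFrac P (algebraMap A (Localization.AtPrime P) a) =
      algebraMap A (FractionRing A) a :=
  IsLocalization.map_eq (M := P.primeCompl) (T := nonZeroDivisors A) (g := RingHom.id A) _ a

theorem localizationToFrac_mk {A : Type*} [CommRing A] [IsDomain A] (P : Ideal A)
    [P.IsPrime] (a : A) (b : P.primeCompl) : localizationToFrac P (Localization.mk a b) =
      algebraMap A (FractionRing A) a / algebraMap A (FractionRing A) b := by
  have hb : algebraMap A (FractionRing A) b ≠ 0 := by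
    simpa using fun h : (b : A) = 0 => b.2 (h ▸ P.zero_mem)
  rw [eq_div_iff hb, ← localizationToFrac_algebraMap P, ← localizationToFrac_algebraMap P,
    ← map_mul, Localization.mk_eq_mk']
  congr 1
  exact IsLocalization.mk'_spec (Localization.AtPrime P) a b

theorem atPrimeToFrac_mk (P : Ideal A) [P.IsPrime]
    (c : HomogeneousLocalization.NumDenSameDeg 𝒜 P.primeCompl) :
    atPrimeToFrac 𝒜 P (HomogeneousLocalization.mk c) =
      algebraMap A (FractionRing A) c.num / algebraMap A (FractionRing A) c.den := by
  have h := localizationToFrac_mk P (c.num : A) ⟨(c.den : A), c.den_mem⟩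
  rw [← HomogeneousLocalization.val_mk] at h
  exact h

theorem mem_range_atPrimeToFrac (P : Ideal A) [P.IsPrime] (z : FractionRing A) :
    z ∈ (atPrimeToFrac 𝒜 P).range ↔ ∃ (i : ℕ) (c d : A), c ∈ 𝒜 i ∧ d ∈ 𝒜 i ∧ d ∉ P ∧
      z = algebraMap A (FractionRing A) c / algebraMap A (FractionRing A) d := by
  constructor
  · rintro ⟨s, rfl⟩
    obtain ⟨c, rfl⟩ := HomogeneousLocalization.mk_surjective s
    exact ⟨c.deg, c.num, c.den, c.num.2, c.den.2, c.den_mem, atPrimeToFrac_mk 𝒜 P c⟩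
  · rintro ⟨i, c, d, hc, hd, hdP, rfl⟩
    exact ⟨.mk ⟨i, ⟨c, hc⟩, ⟨d, hd⟩, hdP⟩, atPrimeToFrac_mk 𝒜 P _⟩

variable [SaturationIndexOne 𝒜]

/-- The prime ideal of a point of `Proj A`. -/
abbrev primeOf (x : Proj 𝒜) : Ideal A := x.asHomogeneousIdeal.toIdeal

instance (x : Proj 𝒜) : (primeOf 𝒜 x).IsPrime := x.isPrime

/-- Near `x` a section is a single fraction `r/t` on some open `V`. The generic point also lies in
`V`, so both germs are computed by the same fraction. -/
theorem functionFieldToFrac_algebraMap (x : Proj 𝒜) (s : (Proj 𝒜).presheaf.stalk x) :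
    functionFieldToFrac 𝒜 (algebraMap _ (Proj 𝒜).functionField s) =
      atPrimeToFrac 𝒜 (primeOf 𝒜 x) ((Proj.stalkIso 𝒜 x).hom.hom s) := by
  obtain ⟨U, hx, s, rfl⟩ := (Proj 𝒜).presheaf.exists_germ_eq s
  have hne : Nonempty U := ⟨⟨x, hx⟩⟩
  rw [Scheme.algebraMap_germ_eq_germToFunctionField]
  have hη : genericPoint (Proj 𝒜) ∈ U :=
    ((genericPoint_spec (Proj 𝒜)).mem_open_set_iff U.isOpen).mpr (by simpa using hne)
  have h1 : (Proj.stalkIso 𝒜 x).hom.hom ((Proj 𝒜).presheaf.germ U x hx s) = s.1 ⟨x, hx⟩ :=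
    Proj.stalkIso'_germ 𝒜 U x hx s
  have h2 : (Proj.stalkIso 𝒜 (genericPoint (Proj 𝒜))).hom.hom
      ((Proj 𝒜).presheaf.germ U (genericPoint (Proj 𝒜)) hη s) = s.1 ⟨_, hη⟩ :=
    Proj.stalkIso'_germ 𝒜 U _ hη s
  obtain ⟨V, hxV, iVU, i, r, t, ht, hV⟩ := s.2 ⟨x, hx⟩
  have hηV : genericPoint (Proj 𝒜) ∈ V :=
    ((genericPoint_spec (Proj 𝒜)).mem_open_set_iff V.isOpen).mpr (by exact ⟨x, Set.mem_univ _, hxV⟩)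
  have e1 : s.1 ⟨x, hx⟩ = .mk ⟨i, r, t, ht ⟨x, hxV⟩⟩ := hV ⟨x, hxV⟩
  have e2 : s.1 ⟨_, hη⟩ = .mk ⟨i, r, t, ht ⟨_, hηV⟩⟩ := hV ⟨_, hηV⟩
  refine (congrArg (atPrimeToFrac 𝒜 (primeOf 𝒜 (genericPoint (Proj 𝒜)))) (h2.trans e2)).trans ?_
  refine Eq.trans ?_ (congrArg (atPrimeToFrac 𝒜 (primeOf 𝒜 x)) (h1.trans e1)).symm
  rw [atPrimeToFrac_mk, atPrimeToFrac_mk]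

theorem functionFieldToFrac_injective : Function.Injective (functionFieldToFrac 𝒜) :=
  RingHom.injective _

/-- Translates regularity at `x` into equations between homogeneous elements of `A`. -/
theorem mem_range_stalk_iff (x : Proj 𝒜) (f : (Proj 𝒜).functionField) :
    f ∈ (algebraMap ((Proj 𝒜).presheaf.stalk x) (Proj 𝒜).functionField).range ↔
      ∃ (i : ℕ) (c d : A), c ∈ 𝒜 i ∧ d ∈ 𝒜 i ∧ d ∉ x.asHomogeneousIdeal ∧
        functionFieldToFrac 𝒜 f =
          algebraMap A (FractionRing A) c / algebraMap A (FractionRing A) d := by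
  refine Iff.trans ?_ (mem_range_atPrimeToFrac 𝒜 (primeOf 𝒜 x) (functionFieldToFrac 𝒜 f))
  constructor
  · rintro ⟨s, rfl⟩
    exact ⟨_, (functionFieldToFrac_algebraMap 𝒜 x s).symm⟩
  · rintro ⟨t, ht⟩
    refine ⟨(Proj.stalkIso 𝒜 x).inv.hom t, functionFieldToFrac_injective 𝒜 ?_⟩
    rw [functionFieldToFrac_algebraMap, ← ht]
    congr 1
    exact (Proj.stalkIso 𝒜 x).commRingCatIsoToRingEquiv.apply_symm_apply t

theorem exists_functionFieldToFrac_eq_div (f : (Proj 𝒜).functionField) :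
    ∃ (i : ℕ) (c d : A), c ∈ 𝒜 i ∧ d ∈ 𝒜 i ∧ d ≠ 0 ∧ functionFieldToFrac 𝒜 f =
      algebraMap A (FractionRing A) c / algebraMap A (FractionRing A) d := by
  obtain ⟨i, c, d, hc, hd, hdx, h⟩ := (mem_range_atPrimeToFrac 𝒜
    (primeOf 𝒜 (genericPoint (Proj 𝒜))) (functionFieldToFrac 𝒜 f)).mp ⟨_, rfl⟩
  exact ⟨i, c, d, hc, hd, fun h0 => hdx (h0 ▸ Ideal.zero_mem _), h⟩

/-- The local rings of `Proj A` are integrally closed when `A` is. -/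
theorem isIntegrallyClosed_stalk_proj [IsIntegrallyClosed A] (x : Proj 𝒜) :
    IsIntegrallyClosed ((Proj 𝒜).presheaf.stalk x) := by
  rw [isIntegrallyClosed_iff (Proj 𝒜).functionField]
  intro f hf
  change f ∈ (algebraMap ((Proj 𝒜).presheaf.stalk x) (Proj 𝒜).functionField).range
  rw [mem_range_stalk_iff]
  let P := primeOf 𝒜 x
  let := (localizationToFrac P).toAlgebra
  have : IsScalarTower A (Localization.AtPrime P) (FractionRing A) :=
    .of_algebraMap_eq fun a => (localizationToFrac_algebraMap P a).symm
  have hint : IsIntegral (Localization.AtPrime P) (functionFieldToFrac 𝒜 f) := by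
    refine hf.map_of_comp_eq ((algebraMap (HomogeneousLocalization.AtPrime 𝒜 P)
      (Localization.AtPrime P)).comp (Proj.stalkIso 𝒜 x).hom.hom) (functionFieldToFrac 𝒜) ?_
    ext s
    exact (functionFieldToFrac_algebraMap 𝒜 x s).symm
  -- Normality of `A` gives `m ∉ P` such that `m` times the fraction is an element `c` of `A`. These
  -- need not be homogeneous, so a component of `m` outside `P` is selected and the corresponding
  -- components of `ma = cb` are compared.
  obtain ⟨⟨m, hm⟩, hmi⟩ :=
    IsIntegral.exists_multiple_integral_of_isLocalization P.primeCompl _ hint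
  obtain ⟨c, hc⟩ := IsIntegrallyClosed.algebraMap_eq_of_integral hmi
  obtain ⟨n, a, b, ha, hb, hb0, hab⟩ := exists_functionFieldToFrac_eq_div 𝒜 f
  have hbK : algebraMap A (FractionRing A) b ≠ 0 := by simpa using hb0
  have hma : m * a = c * b := by
    apply IsFractionRing.injective A (FractionRing A)
    rw [map_mul, map_mul, hc, Submonoid.smul_def, Algebra.smul_def, hab]
    field_simp
  obtain ⟨i, hi⟩ : ∃ i, (DirectSum.decompose 𝒜 m i : A) ∉ P := by
    by_contra! hcon
    refine hm ?_
    classical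
    rw [← DirectSum.sum_support_decompose 𝒜 m]
    exact sum_mem fun i _ => hcon i
  refine ⟨i, DirectSum.decompose 𝒜 c i, DirectSum.decompose 𝒜 m i, SetLike.coe_mem _,
    SetLike.coe_mem _, hi, ?_⟩
  have hcomp : (DirectSum.decompose 𝒜 m i : A) * a = DirectSum.decompose 𝒜 c i * b := by
    have := congrArg (fun z => (DirectSum.decompose 𝒜 z (i + n) : A)) hma
    simpa only [DirectSum.coe_decompose_mul_add_of_right_mem 𝒜 ha,
      DirectSum.coe_decompose_mul_add_of_right_mem 𝒜 hb] using this
  have hmK : algebraMap A (FractionRing A) (DirectSum.decompose 𝒜 m i) ≠ 0 := by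
    simpa using fun h : (DirectSum.decompose 𝒜 m i : A) = 0 => hi (h ▸ P.zero_mem)
  rw [hab, div_eq_div_iff hbK hmK, mul_comm, ← map_mul, hcomp, map_mul]

end ProjStalks

/-! ### The complement of `supp D` as a basic open subset -/

section Complement

theorem QDivisor.mem_complement {X : Scheme.{u}} (D : QDivisor X) (x : X) :
    x ∈ D.complement ↔ ∀ y ∈ D.support, ¬ (y : X) ⤳ x := by
  change x ∈ (QDivisor.supp D)ᶜ ↔ _
  simp only [QDivisor.supp, Set.mem_compl_iff, Set.mem_iUnion, specializes_iff_mem_closure,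
    not_exists]

section Order

variable {X : Scheme.{u}} [IsIntegral X] [IsLocallyNoetherian X]

theorem ord_one (y : X) : Scheme.ord (1 : X.functionField) y = 0 := by
  have := Scheme.ord_mul (x := y) (one_ne_zero (α := X.functionField)) one_ne_zero
  rw [mul_one] at this
  omega

theorem ord_pow {f : X.functionField} (hf : f ≠ 0) (n : ℕ) (y : X) :
    Scheme.ord (f ^ n) y = n * Scheme.ord f y := by
  induction n with
  | zero => simp [ord_one]
  | succ n ih =>
    rw [pow_succ, Scheme.ord_mul (pow_ne_zero n hf) hf, ih]
    push_cast
    ring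

theorem ord_div {f g : X.functionField} (hf : f ≠ 0) (hg : g ≠ 0) (y : X) :
    Scheme.ord (f / g) y = Scheme.ord f y - Scheme.ord g y := by
  have := Scheme.ord_mul (x := y) (div_ne_zero hf hg) hg
  rw [div_mul_cancel₀ _ hg] at this
  omega

end Order

variable {k : Type u} [Field k] {A : Type u} [CommRing A] [Algebra k A]
  {𝒜 : ℕ → Submodule k A} [GradedAlgebra 𝒜]

theorem exists_homogeneous_notMem (x : Proj 𝒜) :
    ∃ (m : ℕ) (b : A), 0 < m ∧ b ∈ 𝒜 m ∧ b ∉ x.asHomogeneousIdeal := by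
  by_contra! hcon
  refine x.not_irrelevant_le fun z hz => ?_
  classical
  rw [← DirectSum.sum_support_decompose 𝒜 z]
  refine x.asHomogeneousIdeal.toIdeal.sum_mem fun i hi => ?_
  rcases Nat.eq_zero_or_pos i with rfl | h
  · have h0 : (DirectSum.decompose 𝒜 z 0 : A) = 0 := (HomogeneousIdeal.mem_irrelevant_iff 𝒜 z).mp hz
    exact h0 ▸ Ideal.zero_mem _
  · exact hcon i _ h (SetLike.coe_mem _)

variable [IsDomain A] [SaturationIndexOne 𝒜] [Algebra.FiniteType k A]

theorem IsPresentation.ne_zero {w : FractionRing A} {H : QDivisor (Proj 𝒜)}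
    (hH : IsPresentation 𝒜 w H) : w ≠ 0 := by
  obtain ⟨ν, a, b, -, -, ha, hb, rfl⟩ := hH.homogeneous
  exact div_ne_zero (by simpa using ha) (by simpa using hb)

/-- Homogeneous elements of degree `n` come from sections of `𝒪(⌊nH⌋)`. -/
theorem IsPresentation.exists_section {w : FractionRing A} {H : QDivisor (Proj 𝒜)}
    (hH : IsPresentation 𝒜 w H) {n : ℕ} {s : A} (hs : s ∈ 𝒜 n) (hs0 : s ≠ 0) :
    ∃ ψ : (Proj 𝒜).functionField, ψ ≠ 0 ∧
      algebraMap A (FractionRing A) s = functionFieldToFrac 𝒜 ψ * w ^ n ∧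
      ∀ y, 0 ≤ (Scheme.ord ψ (y.1 : Proj 𝒜) : ℚ) + n * H y := by
  have h : algebraMap A (FractionRing A) s ∈ (algebraMap A (FractionRing A)) '' (𝒜 n : Set A) :=
    ⟨s, hs, rfl⟩
  rw [hH.image_eq] at h
  obtain ⟨ψ, hψ, hsψ⟩ := h
  have hψ0 : ψ ≠ 0 := by
    rintro rfl
    simp [hs0] at hsψ
  refine ⟨ψ, hψ0, hsψ, fun y => ?_⟩
  have h1 : (0 : ℚ) ≤ ((Scheme.ord ψ (y.1 : Proj 𝒜) + ⌊((n : ℚ) • H) y⌋ : ℤ) : ℚ) :=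
    Int.cast_nonneg (hψ.resolve_left hψ0 y)
  have h2 := Int.floor_le (((n : ℚ) • H) y)
  have h3 : ((n : ℚ) • H) y = n * H y := rfl
  rw [h3] at h1 h2
  push_cast at h1
  linarith

/-- Sections of `𝒪(⌊nH⌋)` give homogeneous elements of degree `n`. -/
theorem IsPresentation.exists_mem {w : FractionRing A} {H : QDivisor (Proj 𝒜)}
    (hH : IsPresentation 𝒜 w H) {n : ℕ} {ψ : (Proj 𝒜).functionField} (hψ0 : ψ ≠ 0)
    (hψ : ∀ y, 0 ≤ (Scheme.ord ψ (y.1 : Proj 𝒜) : ℚ) + n * H y) :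
    ∃ s ∈ 𝒜 n, s ≠ 0 ∧ algebraMap A (FractionRing A) s = functionFieldToFrac 𝒜 ψ * w ^ n := by
  have h : functionFieldToFrac 𝒜 ψ * w ^ n ∈
      (algebraMap A (FractionRing A)) '' (𝒜 n : Set A) := by
    rw [hH.image_eq]
    refine ⟨ψ, Or.inr fun y => ?_, rfl⟩
    -- Orders are integers, so the floor imposes no further condition.
    rw [← neg_le_iff_add_nonneg', Int.le_floor]
    have h3 : ((n : ℚ) • H) y = n * H y := rfl
    rw [h3]
    push_cast
    linarith [hψ y]
  obtain ⟨s, hs, hsψ⟩ := h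
  refine ⟨s, hs, ?_, hsψ⟩
  rintro rfl
  rw [map_zero] at hsψ
  exact mul_ne_zero ((map_ne_zero _).mpr hψ0) (pow_ne_zero n hH.ne_zero) hsψ.symm

/-- If `s` is a section of `𝒪(⌊nH⌋)` with divisor `rE`, then the locus where the homogeneous
element defined by `s` does not vanish is the complement of the support of `E`. -/
theorem IsPresentation.complement_eq_basicOpen [IsIntegrallyClosed A] {w : FractionRing A}
    {H : QDivisor (Proj 𝒜)} (hH : IsPresentation 𝒜 w H) {n : ℕ} {s : A}
    (hs : s ∈ 𝒜 n) {ψ : (Proj 𝒜).functionField} (hψ0 : ψ ≠ 0)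
    (hsψ : algebraMap A (FractionRing A) s = functionFieldToFrac 𝒜 ψ * w ^ n)
    {E : QDivisor (Proj 𝒜)} (hE : E.Effective) {r : ℚ} (hr : 0 < r)
    (hrE : ∀ y, r * E y = Scheme.ord ψ (y.1 : Proj 𝒜) + n * H y) :
    E.complement = Proj.basicOpen 𝒜 s := by
  have hw := hH.ne_zero
  have hψF : functionFieldToFrac 𝒜 ψ ≠ 0 := (map_ne_zero _).mpr hψ0
  ext x
  change x ∈ E.complement ↔ s ∉ x.asHomogeneousIdeal
  rw [QDivisor.mem_complement]
  constructor
  · intro hx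
    obtain ⟨m, b, hm, hb, hbx⟩ := exists_homogeneous_notMem x
    have hb0 : b ≠ 0 := fun h => hbx (h ▸ Ideal.zero_mem _)
    obtain ⟨β, hβ0, hbβ, hβ⟩ := hH.exists_section hb hb0
    -- The exponents make this fraction equal to `b^n / s^m`, of degree zero. On prime divisors
    -- through `x` the coefficient of `E` is zero, so its order is `n (ord β + mH) ≥ 0`.
    have hmem : β ^ n / ψ ^ m ∈
        (algebraMap ((Proj 𝒜).presheaf.stalk x) (Proj 𝒜).functionField).range := by
      refine mem_range_stalk_of_forall_ord_nonneg (isIntegrallyClosed_stalk_proj 𝒜) x _ ?_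
      intro y hy hyx
      rw [ord_div (pow_ne_zero _ hβ0) (pow_ne_zero _ hψ0), ord_pow hβ0, ord_pow hψ0]
      have h1 := hβ ⟨y, hy⟩
      have h2 := hrE ⟨y, hy⟩
      have h3 : E ⟨y, hy⟩ = 0 := by
        by_contra h
        exact hx _ (Finsupp.mem_support_iff.mpr h) hyx
      rw [h3, mul_zero] at h2
      have h4 : (0 : ℚ) ≤ n * Scheme.ord β y - m * Scheme.ord ψ y := by
        have h5 : (Scheme.ord ψ y : ℚ) = - (n * H ⟨y, hy⟩) := by linarith
        rw [h5]
        have := mul_nonneg (Nat.cast_nonneg (α := ℚ) n) h1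
        linarith
      exact_mod_cast h4
    obtain ⟨i, c, d, -, -, hdx, hcd⟩ := (mem_range_stalk_iff 𝒜 x _).mp hmem
    have hd0 : d ≠ 0 := fun h => hdx (h ▸ Ideal.zero_mem _)
    have hdF : algebraMap A (FractionRing A) d ≠ 0 := by simpa using hd0
    have key : b ^ n * d = s ^ m * c := by
      apply IsFractionRing.injective A (FractionRing A)
      rw [map_div₀, map_pow, map_pow, div_eq_div_iff (pow_ne_zero _ hψF) hdF] at hcd
      rw [map_mul, map_mul, map_pow, map_pow, hbβ, hsψ]
      rw [mul_pow, mul_pow, ← pow_mul, ← pow_mul, mul_comm n m]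
      linear_combination w ^ (m * n) * hcd
    intro hsx
    have hprime : (primeOf 𝒜 x).IsPrime := inferInstance
    have : b ^ n * d ∈ primeOf 𝒜 x := by
      rw [key]
      exact Ideal.mul_mem_right _ _ (Ideal.pow_mem_of_mem _ hsx m hm)
    exact (hprime.mem_or_mem this).elim (fun h => hbx (hprime.mem_of_pow_mem n h)) hdx
  · intro hsx y hyE hyx
    have hsy : s ∉ (y.1 : Proj 𝒜).asHomogeneousIdeal :=
      hyx.mem_open (Proj.basicOpen 𝒜 s).isOpen hsx
    have hEy : 0 < E y := lt_of_le_of_ne (hE y) (Finsupp.mem_support_iff.mp hyE).symm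
    -- Ampleness yields a homogeneous `a` of degree `N₂N₁` whose divisor `E'` has coefficient zero
    -- at `y`.
    obtain ⟨N₁, hN₁, -, hample⟩ := hH.ample
    obtain ⟨N₂, hN₂, E', hE', ⟨f, hf0, hf⟩, hyE', -⟩ := hample y.1
    have hEy' : E' y = 0 := by
      by_contra h
      exact (QDivisor.mem_complement E' y.1).mp hyE' y (Finsupp.mem_support_iff.mpr h) specializes_rfl
    have hfH : ∀ z, E' z = Scheme.ord f (z.1 : Proj 𝒜) + (N₂ * N₁ : ℕ) * H z := by
      intro z
      have h1 := hf z
      have h2 : ((N₂ : ℚ) • ((N₁ : ℚ) • H)) z = N₂ * (N₁ * H z) := rfl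
      rw [h2] at h1
      push_cast
      linarith
    obtain ⟨a, ha, -, haf⟩ := hH.exists_mem (n := N₂ * N₁) hf0 fun z => hfH z ▸ hE' z
    -- This is `a^n / s^(N₂N₁)`, regular at `y` if `s` does not vanish there. Its order is `-N₂N₁ ·
    -- r · E y < 0`, a contradiction.
    have hmem : f ^ n / ψ ^ (N₂ * N₁) ∈
        (algebraMap ((Proj 𝒜).presheaf.stalk y.1) (Proj 𝒜).functionField).range := by
      have hprime : (primeOf 𝒜 y.1).IsPrime := inferInstance
      refine (mem_range_stalk_iff 𝒜 y.1 _).mpr ⟨n * (N₂ * N₁), a ^ n, s ^ (N₂ * N₁),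
        SetLike.pow_mem_graded n ha, ?_, fun h => hsy (hprime.mem_of_pow_mem _ h), ?_⟩
      · rw [mul_comm n]
        exact SetLike.pow_mem_graded _ hs
      · rw [map_div₀, map_pow, map_pow, map_pow, map_pow, haf, hsψ]
        rw [mul_pow, mul_pow, ← pow_mul, ← pow_mul, mul_comm n (N₂ * N₁)]
        exact (mul_div_mul_right _ _ (pow_ne_zero _ hw)).symm
    have h1 := ord_nonneg_of_mem_range_stalk y.1 _ hmem
    rw [ord_div (pow_ne_zero _ hf0) (pow_ne_zero _ hψ0), ord_pow hf0, ord_pow hψ0] at h1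
    have h2 : (0 : ℚ) ≤ n * Scheme.ord f y.1 - (N₂ * N₁ : ℕ) * Scheme.ord ψ y.1 := by
      exact_mod_cast h1
    have h3 := hfH y
    have h4 := hrE y
    have h5 : (0 : ℚ) < (N₂ * N₁ : ℕ) * (r * E y) := by positivity
    rw [hEy'] at h3
    have h6 : (Scheme.ord f y.1 : ℚ) = - ((N₂ * N₁ : ℕ) * H y) := by linarith
    rw [h4] at h5
    rw [h6] at h2
    linarith

/-- If `D` is effective and `D ∼ (p/q)H`, then the complement of the support of `D` is a principal
open subset `D₊(h)` with `h` homogeneous of degree `p`. -/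
theorem IsPresentation.exists_complement_eq_basicOpen [IsIntegrallyClosed A] {w : FractionRing A}
    {H : QDivisor (Proj 𝒜)} (hH : IsPresentation 𝒜 w H) {D : QDivisor (Proj 𝒜)}
    (hD : D.Effective) {p q : ℕ} (hq : 0 < q)
    (hDH : D.LinEquiv (((p : ℚ) / (q : ℚ)) • H)) :
    ∃ h ∈ 𝒜 p, h ≠ 0 ∧ D.complement = Proj.basicOpen 𝒜 h := by
  obtain ⟨φ, hφ0, hφ⟩ := hDH
  have hqD : ∀ y, (q : ℚ) * D y = Scheme.ord (φ ^ q) (y.1 : Proj 𝒜) + p * H y := by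
    intro y
    have h1 := hφ y
    have h2 : (((p : ℚ) / (q : ℚ)) • H) y = (p : ℚ) / q * H y := rfl
    rw [h2, sub_eq_iff_eq_add] at h1
    rw [ord_pow hφ0, h1]
    push_cast
    field_simp
  obtain ⟨h, hhp, hh0, hhφ⟩ := hH.exists_mem (pow_ne_zero q hφ0) fun y =>
    hqD y ▸ mul_nonneg (Nat.cast_nonneg q) (hD y)
  exact ⟨h, hhp, hh0, hH.complement_eq_basicOpen hhp (pow_ne_zero q hφ0) hhφ hD
    (Nat.cast_pos.mpr hq) hqD⟩

end Complement

/-! ### The localized Veronese ring as a Laurent polynomial ring -/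

section Laurent

variable {k : Type u} [Field k] {A : Type u} [CommRing A] [Algebra k A]
  (𝒜 : ℕ → Submodule k A) [GradedAlgebra 𝒜]

/-- The `k`-algebra structure on the degree zero part of `A_h`. -/
@[reducible]
def awayAlgebra (h : A) : Algebra k (HomogeneousLocalization.Away 𝒜 h) :=
  ((HomogeneousLocalization.fromZeroRingHom 𝒜 (Submonoid.powers h)).comp
    (algebraMap k (𝒜 0))).toAlgebra

attribute [local instance] awayAlgebra

theorem mem_veronese_of_mem {p n : ℕ} {a : A} (ha : a ∈ 𝒜 (p * n)) : a ∈ veronese 𝒜 p :=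
  Submodule.mem_iSup_of_mem (p := fun ν => 𝒜 (p * ν)) n ha

variable [IsDomain A]

/-- The inclusion of `A_h` into the fraction field of the domain `A`. -/
def awayLift {h : A} (h0 : h ≠ 0) : Localization.Away h →+* FractionRing A :=
  IsLocalization.Away.lift h (g := algebraMap A (FractionRing A)) (by simpa using h0)

theorem awayLift_algebraMap {h : A} (h0 : h ≠ 0) (a : A) :
    awayLift h0 (algebraMap A _ a) = algebraMap A (FractionRing A) a :=
  IsLocalization.Away.lift_eq h _ a

theorem awayLift_mk {h : A} (h0 : h ≠ 0) (a : A) (n : ℕ) :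
    awayLift h0 (Localization.mk a ⟨h ^ n, n, rfl⟩) =
      algebraMap A (FractionRing A) a / algebraMap A (FractionRing A) h ^ n := by
  have hn : algebraMap A (FractionRing A) h ^ n ≠ 0 := pow_ne_zero _ (by simpa using h0)
  rw [eq_div_iff hn, ← map_pow, ← awayLift_algebraMap h0, ← awayLift_algebraMap h0, ← map_mul,
    Localization.mk_eq_mk']
  congr 1
  exact IsLocalization.mk'_spec (Localization.Away h) a _

theorem awayLift_injective {h : A} (h0 : h ≠ 0) : Function.Injective (awayLift h0) := by
  rw [awayLift, IsLocalization.Away.lift, IsLocalization.lift_injective_iff]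
  intro x y
  rw [(IsFractionRing.injective A (FractionRing A)).eq_iff,
    (IsLocalization.injective (Localization.Away h)
      (powers_le_nonZeroDivisors_of_noZeroDivisors h0)).eq_iff]

/-- The inclusion of the degree zero part of `A_h` into the fraction field of `A`. -/
def awayToFrac {h : A} (h0 : h ≠ 0) :
    HomogeneousLocalization.Away 𝒜 h →ₐ[k] FractionRing A where
  __ := (awayLift h0).comp (algebraMap (HomogeneousLocalization.Away 𝒜 h) (Localization.Away h))
  commutes' r := by
    have h1 : (algebraMap k (HomogeneousLocalization.Away 𝒜 h) r).val =
        algebraMap A (Localization.Away h) (algebraMap k A r) :=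
      Localization.mk_one_eq_algebraMap _
    refine (congrArg (awayLift h0) h1).trans ?_
    rw [awayLift_algebraMap, ← IsScalarTower.algebraMap_apply]

theorem awayToFrac_apply {h : A} (h0 : h ≠ 0) (z : HomogeneousLocalization.Away 𝒜 h) :
    awayToFrac 𝒜 h0 z = awayLift h0 z.val := rfl

theorem awayToFrac_mk {h : A} (h0 : h ≠ 0) {p : ℕ} (hp : h ∈ 𝒜 p) (n : ℕ) (a : A)
    (ha : a ∈ 𝒜 (n • p)) : awayToFrac 𝒜 h0 (HomogeneousLocalization.Away.mk 𝒜 hp n a ha) =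
      algebraMap A (FractionRing A) a / algebraMap A (FractionRing A) h ^ n :=
  awayLift_mk h0 a n

theorem awayToFrac_injective {h : A} (h0 : h ≠ 0) : Function.Injective (awayToFrac 𝒜 h0) :=
  (awayLift_injective h0).comp (HomogeneousLocalization.val_injective _)

/-- A homogeneous element `h` of positive degree is transcendental over the degree zero part
of `A_h`. -/
theorem eval₂_awayToFrac_injective {h : A} (h0 : h ≠ 0) {p : ℕ} (hp : h ∈ 𝒜 p) (hp0 : 0 < p) :
    Function.Injective (Polynomial.eval₂RingHom (awayToFrac 𝒜 h0).toRingHom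
      (algebraMap A (FractionRing A) h)) := by
  rw [injective_iff_map_eq_zero]
  intro P hP
  rw [Polynomial.coe_eval₂RingHom, Polynomial.eval₂_eq_sum, Polynomial.sum] at hP
  -- One power `h^n` clears the denominators of all coefficients at once.
  have hev : ∀ᶠ n in Filter.atTop, ∀ i ∈ P.support, ∃ a ∈ 𝒜 (n • p),
      algebraMap A (FractionRing A) h ^ n * awayToFrac 𝒜 h0 (P.coeff i) =
        algebraMap A (FractionRing A) a := by
    rw [Filter.eventually_all_finset]
    intro i _
    filter_upwards [HomogeneousLocalization.Away.eventually_smul_mem hp (P.coeff i)]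
    rintro n ⟨a, ha, hna⟩
    refine ⟨a, ha, ?_⟩
    rw [← awayLift_algebraMap h0 a, hna, Algebra.smul_def, map_mul, awayLift_algebraMap, map_pow,
      awayToFrac_apply]
  obtain ⟨n, hn⟩ := hev.exists
  choose! a ha hna using hn
  have hsum : ∑ i ∈ P.support, a i * h ^ i = 0 := by
    apply IsFractionRing.injective A (FractionRing A)
    rw [map_sum, map_zero, ← mul_zero (algebraMap A (FractionRing A) h ^ n), ← hP, Finset.mul_sum]
    refine Finset.sum_congr rfl fun i hi => ?_
    rw [map_mul, map_pow, ← hna i hi, mul_assoc]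
    rfl
  -- The terms have pairwise distinct degrees `(n + i)p`, since `p > 0`, so each of them vanishes
  -- separately.
  have hmem : ∀ i ∈ P.support, a i * h ^ i ∈ 𝒜 ((n + i) • p) := fun i hi => by
    rw [add_smul]
    exact SetLike.mul_mem_graded (ha i hi) (SetLike.pow_mem_graded i hp)
  by_contra hP0
  obtain ⟨j, hj⟩ := Polynomial.nonempty_support_iff.mpr hP0
  have hj0 : a j * h ^ j = 0 := by
    have h1 := congrArg (GradedRing.proj 𝒜 ((n + j) • p)) hsum
    simp only [map_sum, map_zero, GradedRing.proj_apply] at h1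
    rw [Finset.sum_eq_single_of_mem j hj] at h1
    · rwa [DirectSum.decompose_of_mem_same 𝒜 (hmem j hj)] at h1
    · intro i hi hij
      refine DirectSum.decompose_of_mem_ne 𝒜 (hmem i hi) ?_
      intro heq
      have := Nat.eq_of_mul_eq_mul_right hp0 heq
      omega
  have haj : a j = 0 := (mul_eq_zero.mp hj0).resolve_right (pow_ne_zero _ h0)
  have h2 := hna j hj
  rw [haj, map_zero, mul_eq_zero, map_eq_zero_iff _ (awayToFrac_injective 𝒜 h0)] at h2
  exact Polynomial.mem_support_iff.mp hj (h2.resolve_left (pow_ne_zero _ (by simpa using h0)))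

/-- The Laurent polynomial ring over the degree zero part of `A_h`, mapped to the fraction field
of `A` by sending the variable to `h`. -/
def laurentToFrac {h : A} (h0 : h ≠ 0) :
    LaurentPolynomial (HomogeneousLocalization.Away 𝒜 h) →ₐ[k] FractionRing A where
  __ := LaurentPolynomial.eval₂ (awayToFrac 𝒜 h0).toRingHom
    (Units.mk0 (algebraMap A (FractionRing A) h) (by simpa using h0))
  commutes' r := by
    refine (LaurentPolynomial.eval₂_C _ _ _).trans ?_
    exact (awayToFrac 𝒜 h0).commutes r

theorem laurentToFrac_C_mul_T {h : A} (h0 : h ≠ 0) (b : HomogeneousLocalization.Away 𝒜 h)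
    (n : ℤ) : laurentToFrac 𝒜 h0 (LaurentPolynomial.C b * LaurentPolynomial.T n) =
      awayToFrac 𝒜 h0 b * algebraMap A (FractionRing A) h ^ n := by
  refine (LaurentPolynomial.eval₂_C_mul_T _ _ _ _).trans ?_
  simp

/-- A power of the unit `T` turns a Laurent polynomial into a polynomial, which reduces the claim to
the transcendence of `h`. -/
theorem laurentToFrac_injective {h : A} (h0 : h ≠ 0) {p : ℕ} (hp : h ∈ 𝒜 p) (hp0 : 0 < p) :
    Function.Injective (laurentToFrac 𝒜 h0) := by
  rw [injective_iff_map_eq_zero]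
  intro f hf
  obtain ⟨n, g, hg⟩ := f.exists_T_pow
  have h1 : laurentToFrac 𝒜 h0 g.toLaurent = 0 := by rw [hg, map_mul, hf, zero_mul]
  have h2 : g = 0 := by
    apply eval₂_awayToFrac_injective 𝒜 h0 hp hp0
    rw [map_zero]
    exact (LaurentPolynomial.eval₂_toLaurent _ _ g).symm.trans h1
  rw [h2, map_zero] at hg
  exact (LaurentPolynomial.isUnit_T _).mul_left_eq_zero.mp hg.symm

/-- The localization of the Veronese subring, mapped to the fraction field of `A`. -/
def veroneseToFrac {p : ℕ} (h : veronese 𝒜 p) (h0 : h ≠ 0) :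
    Localization.Away h →ₐ[k] FractionRing A :=
  IsLocalization.liftAlgHom (M := Submonoid.powers h)
    (f := (IsScalarTower.toAlgHom k A (FractionRing A)).comp (veronese 𝒜 p).val) <| by
    rintro ⟨_, n, rfl⟩
    simpa using pow_ne_zero n h0

theorem veroneseToFrac_algebraMap {p : ℕ} (h : veronese 𝒜 p) (h0 : h ≠ 0) (a : veronese 𝒜 p) :
    veroneseToFrac 𝒜 h h0 (algebraMap _ _ a) = algebraMap A (FractionRing A) a :=
  IsLocalization.lift_eq _ a

theorem veroneseToFrac_injective {p : ℕ} (h : veronese 𝒜 p) (h0 : h ≠ 0) :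
    Function.Injective (veroneseToFrac 𝒜 h h0) := by
  rw [injective_iff_map_eq_zero]
  intro z hz
  obtain ⟨a, ⟨_, n, rfl⟩, rfl⟩ := IsLocalization.exists_mk'_eq (Submonoid.powers h) z
  have h1 := congrArg (veroneseToFrac 𝒜 h h0)
    (IsLocalization.mk'_spec (Localization.Away h) a (⟨_, n, rfl⟩ : Submonoid.powers h))
  rw [map_mul, hz, zero_mul, veroneseToFrac_algebraMap] at h1
  have h2 : a = 0 := by simpa using h1.symm
  rw [h2, IsLocalization.mk'_zero]

/-- An element `x` of degree `pn` equals `(x/h^n) h^n`; conversely, an element of `A_(h)` is `a/h^m`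
with `a` of degree `pm`, hence in the Veronese ring. -/
theorem range_veroneseToFrac {p : ℕ} (h : veronese 𝒜 p) (h0 : h ≠ 0) (h0' : (h : A) ≠ 0)
    (hp : (h : A) ∈ 𝒜 p) :
    (veroneseToFrac 𝒜 h h0).range = (laurentToFrac 𝒜 h0').range := by
  have hK : algebraMap A (FractionRing A) h ≠ 0 := by simpa using h0'
  have hTinv : (algebraMap A (FractionRing A) h)⁻¹ ∈ (veroneseToFrac 𝒜 h h0).range := by
    refine ⟨IsLocalization.Away.invSelf h, ?_⟩
    have h1 := congrArg (veroneseToFrac 𝒜 h h0)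
      (IsLocalization.Away.mul_invSelf (S := Localization.Away h) h)
    rw [map_mul, map_one, veroneseToFrac_algebraMap] at h1
    exact eq_inv_of_mul_eq_one_right h1
  have hT : algebraMap A (FractionRing A) h ∈ (veroneseToFrac 𝒜 h h0).range :=
    ⟨_, veroneseToFrac_algebraMap 𝒜 h h0 h⟩
  have hTz : ∀ n : ℤ, algebraMap A (FractionRing A) h ^ n ∈ (veroneseToFrac 𝒜 h h0).range := by
    intro n
    obtain ⟨m, rfl | rfl⟩ := n.eq_nat_or_neg
    · simpa using pow_mem hT m
    · simpa using pow_mem hTinv m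
  have hLz : ∀ n : ℤ, algebraMap A (FractionRing A) h ^ n ∈ (laurentToFrac 𝒜 h0').range := by
    intro n
    refine ⟨LaurentPolynomial.C 1 * LaurentPolynomial.T n, ?_⟩
    exact (laurentToFrac_C_mul_T 𝒜 h0' 1 n).trans (by simp)
  refine le_antisymm ?_ ?_
  · rintro _ ⟨z, rfl⟩
    obtain ⟨a, ⟨_, n, rfl⟩, rfl⟩ := IsLocalization.exists_mk'_eq (Submonoid.powers h) z
    have h1 : veroneseToFrac 𝒜 h h0 (IsLocalization.mk' (Localization.Away h) a (⟨_, n, rfl⟩ : Submonoid.powers h)) =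
        algebraMap A (FractionRing A) a * algebraMap A (FractionRing A) h ^ (-(n : ℤ)) := by
      rw [zpow_neg, zpow_natCast, ← div_eq_mul_inv, eq_div_iff (pow_ne_zero _ hK)]
      have h2 := congrArg (veroneseToFrac 𝒜 h h0)
        (IsLocalization.mk'_spec (Localization.Away h) a (⟨_, n, rfl⟩ : Submonoid.powers h))
      rw [map_mul, veroneseToFrac_algebraMap, veroneseToFrac_algebraMap] at h2
      simpa using h2
    refine h1 ▸ mul_mem ?_ (hLz _)
    clear h1
    obtain ⟨a, ha⟩ := a
    change a ∈ ⨆ ν : ℕ, 𝒜 (p * ν) at ha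
    change algebraMap A (FractionRing A) a ∈ _
    induction ha using Submodule.iSup_induction' with
    | zero => simp
    | add x y _ _ hx hy => rw [map_add]; exact add_mem hx hy
    | mem n x hx =>
      have hx' : x ∈ 𝒜 (n • p) := by rwa [smul_eq_mul, mul_comm]
      refine ⟨LaurentPolynomial.C (HomogeneousLocalization.Away.mk 𝒜 hp n x hx') *
        LaurentPolynomial.T n, ?_⟩
      refine (laurentToFrac_C_mul_T 𝒜 h0' _ n).trans ?_
      rw [awayToFrac_mk, zpow_natCast, div_mul_cancel₀ _ (pow_ne_zero _ hK)]
  · rintro _ ⟨z, rfl⟩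
    change laurentToFrac 𝒜 h0' z ∈ _
    induction z using LaurentPolynomial.induction_on' with
    | add x y hx hy => rw [map_add]; exact add_mem hx hy
    | C_mul_T n b =>
      obtain ⟨m, a, ha, rfl⟩ := HomogeneousLocalization.Away.mk_surjective 𝒜 hp b
      rw [laurentToFrac_C_mul_T, awayToFrac_mk, div_eq_mul_inv, ← zpow_natCast, ← zpow_neg]
      have ha' : a ∈ 𝒜 (p * m) := by rwa [mul_comm, ← smul_eq_mul]
      exact mul_mem (mul_mem ⟨_, veroneseToFrac_algebraMap 𝒜 h h0 ⟨a, mem_veronese_of_mem 𝒜 ha'⟩⟩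
        (hTz _)) (hTz _)

/-- If `h` is homogeneous of degree `p > 0`, then the localization of the `p`-th Veronese subring
at `h` is the Laurent polynomial ring over the degree zero part of `A_h`. -/
def veroneseAwayEquiv {p : ℕ} (hp0 : 0 < p) (h : veronese 𝒜 p) (h0 : h ≠ 0) (hp : (h : A) ∈ 𝒜 p) :
    Localization.Away h ≃ₐ[k] LaurentPolynomial (HomogeneousLocalization.Away 𝒜 (h : A)) :=
  have h0' : (h : A) ≠ 0 := by simpa using h0
  ((AlgEquiv.ofInjective _ (veroneseToFrac_injective 𝒜 h h0)).trans
    (Subalgebra.equivOfEq _ _ (range_veroneseToFrac 𝒜 h h0 h0' hp))).trans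
    (AlgEquiv.ofInjective _ (laurentToFrac_injective 𝒜 h0' hp hp0)).symm

end Laurent

/-! ### Affine `k`-schemes, products and varieties -/

section Products

open scoped TensorProduct

variable (k : Type u) [Field k]

theorem specMap_comp_specOver_hom {B C : Type u} [CommRing B] [CommRing C] [Algebra k B]
    [Algebra k C] (f : B →+* C) (hf : f.comp (algebraMap k B) = algebraMap k C) :
    Spec.map (CommRingCat.ofHom f) ≫ (specOver k B).hom = (specOver k C).hom := by
  refine (Spec.map_comp _ _).symm.trans ?_
  rw [← CommRingCat.ofHom_comp, hf]
  rfl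

/-- Isomorphic `k`-algebras have isomorphic spectra. -/
def specOverIso {B C : Type u} [CommRing B] [CommRing C] [Algebra k B] [Algebra k C]
    (e : B ≃ₐ[k] C) : specOver k B ≅ specOver k C :=
  Over.isoMk (Scheme.Spec.mapIso e.toRingEquiv.toCommRingCatIso.symm.op)
    (specMap_comp_specOver_hom k (e.symm.toAlgHom : C →+* B) e.symm.toAlgHom.comp_algebraMap)

/-- The spectrum of a tensor product is the product of the spectra. -/
def specOverTensorIso (B C : Type u) [CommRing B] [CommRing C] [Algebra k B] [Algebra k C] :
    specOver k (B ⊗[k] C) ≅ specOver k B ⨯ specOver k C :=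
  have h₁ : IsPullback
      (Spec.map (CommRingCat.ofHom (Algebra.TensorProduct.includeLeftRingHom : B →+* B ⊗[k] C)))
      (Spec.map (CommRingCat.ofHom
        (Algebra.TensorProduct.includeRight : C →ₐ[k] B ⊗[k] C).toRingHom))
      (specOver k B).hom (specOver k C).hom :=
    isPullback_SpecMap_of_isPushout _ _ _ _ (CommRingCat.isPushout_tensorProduct k B C)
  have h₂ := Over.isPullback_of_binaryFan_isLimit _ (prodIsProd (specOver k B) (specOver k C))
  Over.isoMk (h₁.isoIsPullback _ _ h₂) <| by
    rw [← Over.w (prod.fst : specOver k B ⨯ specOver k C ⟶ _)]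
    refine (IsPullback.isoIsPullback_hom_fst_assoc _ _ h₁ h₂ _).trans ?_
    exact specMap_comp_specOver_hom k _
      (Algebra.TensorProduct.includeLeft : B →ₐ[k] B ⊗[k] C).comp_algebraMap

/-- The product of `Spec B` and the punctured line is the spectrum of the Laurent polynomial ring
over `B`. -/
def specOverLaurentIso (B : Type u) [CommRing B] [Algebra k B] :
    specOver k (LaurentPolynomial B) ≅ specOver k B ⨯ puncturedLine k :=
  specOverIso k ((AddMonoidAlgebra.scalarTensorEquiv k B (M := ℤ)).restrictScalars k).symm ≪≫
    specOverTensorIso k B (LaurentPolynomial k)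

variable {k}

/-- A principal open subset of `Spec B` is the spectrum of the localization. -/
def principalOpenIso {B : Type u} [CommRing B] [Algebra k B] (h : B) :
    principalOpen k h ≅ specOver k (Localization.Away h) :=
  Over.isoMk (basicOpenIsoSpecAway (R := CommRingCat.of B) h) <| by
    change _ ≫ Spec.map (CommRingCat.ofHom (algebraMap k (Localization.Away h))) = _ ≫
      Spec.map (CommRingCat.ofHom (algebraMap k B))
    rw [IsScalarTower.algebraMap_eq k B (Localization.Away h), CommRingCat.ofHom_comp,
      Spec.map_comp]
    exact basicOpenIsoSpecAway_hom_SpecMap_assoc (R := CommRingCat.of B) h _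

/-- An affine `k`-scheme is the spectrum of a `k`-algebra. -/
theorem exists_iso_specOver (Z : KScheme k) (hZ : IsAffine Z.left) :
    ∃ (R : Type u) (_ : CommRing R) (_ : Algebra k R), Nonempty (Z ≅ specOver k R) := by
  let φ : CommRingCat.of k ⟶ Γ(Z.left, ⊤) := (Scheme.ΓSpecIso (CommRingCat.of k)).inv ≫ Z.hom.appTop
  let _ : Algebra k Γ(Z.left, ⊤) := φ.hom.toAlgebra
  refine ⟨Γ(Z.left, ⊤), inferInstance, inferInstance, ⟨Over.isoMk Z.left.isoSpec ?_⟩⟩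
  change Z.left.isoSpec.hom ≫ Spec.map φ = Z.hom
  rw [Spec.map_comp, Scheme.isoSpec_hom_naturality_assoc]
  simp [Scheme.isoSpec_hom]

theorem isAffine_of_iso {Z : KScheme k} {R : Type u} [CommRing R] [Algebra k R]
    (e : Z ≅ specOver k R) : IsAffine Z.left :=
  have : IsIso e.hom.left := inferInstanceAs (IsIso ((Over.forget _).map e.hom))
  have : IsAffine (specOver k R).left := inferInstanceAs (IsAffine (Spec (CommRingCat.of R)))
  .of_isIso e.hom.left

theorem isVariety_of_iso {Z Z' : KScheme k} (e : Z ≅ Z') (hZ : IsVariety Z) : IsVariety Z' := by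
  have : IsIso e.inv.left := inferInstanceAs (IsIso ((Over.forget _).map e.inv))
  have hw : e.inv.left ≫ Z.hom = Z'.hom := Over.w e.inv
  have := hZ.integral
  have := hZ.separated
  have := hZ.locallyOfFiniteType
  have := hZ.quasiCompact
  have : Nonempty Z'.left := ⟨e.hom.left (IsIntegral.nonempty (X := Z.left)).some⟩
  have : IsIntegral Z'.left := isIntegral_of_isOpenImmersion e.inv.left
  exact ⟨this, hw ▸ inferInstance, hw ▸ inferInstance, hw ▸ inferInstance⟩

theorem isVariety_specOver_iff (R : Type u) [CommRing R] [Algebra k R] :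
    IsVariety (specOver k R) ↔ IsDomain R ∧ Algebra.FiniteType k R := by
  constructor
  · intro h
    have h1 : IsIntegral (Spec (CommRingCat.of R)) := h.integral
    have h2 : LocallyOfFiniteType (Spec.map (CommRingCat.ofHom (algebraMap k R))) :=
      h.locallyOfFiniteType
    rw [HasRingHomProperty.Spec_iff (P := @LocallyOfFiniteType)] at h2
    exact ⟨(affine_isIntegral_iff _).mp h1, RingHom.finiteType_algebraMap.mp h2⟩
  · rintro ⟨h1, h2⟩
    refine ⟨(affine_isIntegral_iff (CommRingCat.of R)).mpr h1, ?_, ?_, ?_⟩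
    · change IsSeparated (Spec.map _); infer_instance
    · change LocallyOfFiniteType (Spec.map _)
      rw [HasRingHomProperty.Spec_iff (P := @LocallyOfFiniteType)]
      exact RingHom.finiteType_algebraMap.mpr h2
    · change QuasiCompact (Spec.map _); infer_instance

/-- If `Z × 𝔸¹` is affine and `Z` is separated over `k`, then `Z` is affine. -/
theorem isAffine_of_isAffine_prod {Z : KScheme k}
    (h : IsAffine (Z ⨯ affineLine k).left) : IsAffine Z.left := by
  let s : specOver k k ⟶ affineLine k := Over.homMk (Spec.map (CommRingCat.ofHom
    (Polynomial.aeval (R := k) (0 : k)).toRingHom)) <| by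
      change Spec.map _ ≫ Spec.map (CommRingCat.ofHom (algebraMap k (Polynomial k))) = Spec.map _
      rw [← Spec.map_comp, ← CommRingCat.ofHom_comp]
      congr 2
      exact (Polynomial.aeval (R := k) (0 : k)).comp_algebraMap
  let t : Z ⟶ specOver k k := Over.homMk Z.hom <| by
    change Z.hom ≫ Spec.map (𝟙 _) = Z.hom
    rw [Spec.map_id]
    exact Category.comp_id _
  -- The zero section of the projection to `Z`. The projection is a base change of `𝔸¹ → Spec k`,
  -- hence separated, so its section is a closed immersion.
  let σ : Z ⟶ Z ⨯ affineLine k := prod.lift (𝟙 Z) (t ≫ s)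
  have hσ : σ.left ≫ (prod.fst : Z ⨯ affineLine k ⟶ Z).left = 𝟙 _ := by
    rw [← Over.comp_left, prod.lift_fst]; rfl
  have hsep : IsSeparated (prod.fst : Z ⨯ affineLine k ⟶ Z).left := by
    have := Over.isPullback_of_binaryFan_isLimit _ (prodIsProd Z (affineLine k))
    have hA : IsSeparated (affineLine k).hom :=
      inferInstanceAs (IsSeparated (Spec.map (CommRingCat.ofHom (algebraMap k (Polynomial k)))))
    exact MorphismProperty.of_isPullback this.flip hA
  have : IsClosedImmersion σ.left := by
    have : IsClosedImmersion (σ.left ≫ (prod.fst : Z ⨯ affineLine k ⟶ Z).left) := by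
      rw [hσ]; infer_instance
    exact IsClosedImmersion.of_comp σ.left (prod.fst : Z ⨯ affineLine k ⟶ Z).left
  exact isAffine_of_isAffineHom σ.left

end Products

/-! ### Basic open subsets of `Proj A` over `k` -/

section ProjOpen

variable {k : Type u} [Field k] {A : Type u} [CommRing A] [Algebra k A]
  (𝒜 : ℕ → Submodule k A) [GradedAlgebra 𝒜]

attribute [local instance] awayAlgebra

/-- The principal open subset `D₊(h)` of `Proj A` is the spectrum of the degree zero part
of `A_h`. -/
def openOverBasicOpenIso {h : A} {p : ℕ} (hp : h ∈ 𝒜 p) (hp0 : 0 < p) :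
    openOver 𝒜 (Proj.basicOpen 𝒜 h) ≅ specOver k (HomogeneousLocalization.Away 𝒜 h) :=
  (Over.isoMk (Proj.basicOpenIsoSpec 𝒜 h hp hp0).symm <| by
    change (Proj.basicOpenIsoSpec 𝒜 h hp hp0).inv ≫ (Proj.basicOpen 𝒜 h).ι ≫ Proj.toSpecZero 𝒜 ≫
      Spec.map (CommRingCat.ofHom (algebraMap k (𝒜 0))) = Spec.map (CommRingCat.ofHom _)
    rw [Proj.basicOpenIsoSpec_inv_ι_assoc, Proj.awayι_toSpecZero_assoc, ← Spec.map_comp]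
    rfl).symm

end ProjOpen

end Cylindrical

end

/-! ### The product decomposition of `𝔻(h)` -/

theorem lemma2p8 {k : Type u} [Field k] [IsAlgClosed k] [CharZero k]
    {A : Type u} [CommRing A] [IsDomain A] [IsIntegrallyClosed A]
    [Algebra k A] [Algebra.FiniteType k A]
    (𝒜 : ℕ → Submodule k A) [GradedAlgebra 𝒜] [Cylindrical.SaturationIndexOne 𝒜]
    (w : FractionRing A) (H : Cylindrical.QDivisor (Proj 𝒜))
    (hH : Cylindrical.IsPresentation 𝒜 w H)
    (D : Cylindrical.QDivisor (Proj 𝒜)) (hD : D.Effective)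
    (p q : ℕ) (hp : 0 < p) (hq : 0 < q) (hpq : Nat.Coprime p q)
    (hDH : D.LinEquiv (((p : ℚ) / (q : ℚ)) • H))
    (Z : Cylindrical.KScheme k) (hZ : Cylindrical.IsVariety Z)
    (hcyl : Nonempty (Cylindrical.openOver 𝒜 D.complement ≅ Z ⨯ Cylindrical.affineLine k)) :
    Cylindrical.IsCylindrical k (Cylindrical.veronese 𝒜 p) ∧
    IsAffine Z.left ∧
    ∃ h : Cylindrical.veronese 𝒜 p, h ≠ 0 ∧ (h : A) ∈ 𝒜 p ∧
      ∃ Z' : Cylindrical.KScheme k, Cylindrical.IsVariety Z' ∧ IsAffine Z'.left ∧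
        Nonempty (Z' ≅ Z ⨯ Cylindrical.puncturedLine k) ∧
        Nonempty (Cylindrical.principalOpen k h ≅ Z' ⨯ Cylindrical.affineLine k) := by
  obtain ⟨h, hhp, hh0, hDh⟩ := hH.exists_complement_eq_basicOpen hD hq hDH
  rw [hDh] at hcyl
  obtain ⟨e⟩ := hcyl
  let := Cylindrical.awayAlgebra 𝒜 h
  let e₀ := Cylindrical.openOverBasicOpenIso 𝒜 hhp hp
  have haff : IsAffine (Z ⨯ Cylindrical.affineLine k).left :=
    Cylindrical.isAffine_of_iso (e.symm ≪≫ e₀)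
  have hZaff := Cylindrical.isAffine_of_isAffine_prod haff
  obtain ⟨R, _, _, ⟨eR⟩⟩ := Cylindrical.exists_iso_specOver Z hZaff
  obtain ⟨_, _⟩ := (Cylindrical.isVariety_specOver_iff R).mp (Cylindrical.isVariety_of_iso eR hZ)
  -- Taking `Z'` as a spectrum, rather than as the product itself, makes it affine by construction
  -- and reduces being a variety to algebra.
  let Z' := Cylindrical.specOver k (LaurentPolynomial R)
  have hZ' : Cylindrical.IsVariety Z' := by
    refine (Cylindrical.isVariety_specOver_iff _).mpr ⟨inferInstance, ?_⟩
    have : Algebra.FiniteType R (LaurentPolynomial R) :=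
      AddMonoidAlgebra.finiteType_of_fg (R := R) (M := ℤ)
    exact Algebra.FiniteType.trans ‹Algebra.FiniteType k R› this
  let eZ' : Z' ≅ Z ⨯ Cylindrical.puncturedLine k :=
    Cylindrical.specOverLaurentIso k R ≪≫ Limits.prod.mapIso eR.symm (Iso.refl _)
  let h' : Cylindrical.veronese 𝒜 p := ⟨h, Cylindrical.mem_veronese_of_mem 𝒜 (n := 1) (by rwa [mul_one])⟩
  have hh' : h' ≠ 0 := fun h0 => hh0 (congrArg Subtype.val h0)
  -- The chain runs through `Spec A_(h) × 𝔸¹_*` and `(Z × 𝔸¹) × 𝔸¹_*`, and then exchanges the two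
  -- lines to reach `(Z × 𝔸¹_*) × 𝔸¹`.
  let eh : Cylindrical.principalOpen k h' ≅ Z' ⨯ Cylindrical.affineLine k :=
    Cylindrical.principalOpenIso h' ≪≫ Cylindrical.specOverIso k (Cylindrical.veroneseAwayEquiv 𝒜 hp h' hh' hhp) ≪≫
      Cylindrical.specOverLaurentIso k _ ≪≫ Limits.prod.mapIso (e₀.symm ≪≫ e) (Iso.refl _) ≪≫
      Limits.prod.associator _ _ _ ≪≫ Limits.prod.mapIso (Iso.refl _) (Limits.prod.braiding _ _) ≪≫
      (Limits.prod.associator _ _ _).symm ≪≫ Limits.prod.mapIso eZ'.symm (Iso.refl _)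
  have hZ'aff : IsAffine Z'.left :=
    inferInstanceAs (IsAffine (Spec (CommRingCat.of (LaurentPolynomial R))))
  exact ⟨⟨h', hh', Z', hZ', ⟨eh⟩⟩, hZaff, h', hh', hhp, Z', hZ', hZ'aff, ⟨eZ'⟩, ⟨eh⟩⟩
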